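/- For a group $G$ and a subset $S\subseteq G$, let $\mathrm{Cay}(G,S)$ be the digraph with vertex set $G$ in which $(g,h)$ is an arc if and only if $gh^{-1}\in S$. It is bipartite if its vertex set can be partitioned into two sets such that every arc joins vertices in different sets, and it is a DRR (digraphical regular representation) if its automorphism group consists exactly of the right multiplications $x\mapsto xg$ with $g\in G$. For a finite abelian group $A$ of even order, let $$\mathcal S_A=\{S\subseteq A\mid \mathrm{Cay}(A,S)\text{ is bipartite}\},\qquad \mathcal D_A=\{S\in\mathcal S_A\mid \mathrm{Cay}(A,S)\text{ is a DRR}\}.$$ Then $|\mathcal D_A|/|\mathcal S_A|\to 1$ as $|A|\to\infty$, uniformly over all such groups; that is, for every $\varepsilon>0$ there is $N\in\mathbb N$ such that for every finite abelian group $A$ of even order with $|A|\ge N$, $$\left|\frac{|\mathcal D_A|}{|\mathcal S_A|}-1\right|<\varepsilon .$$ -/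

import Mathlib

/-- A digraph is bipartite if its vertex set splits into two parts `X` and `Xᶜ` such that
every arc joins vertices of different parts. -/
def Digraph.IsBipartite {V : Type*} (D : Digraph V) : Prop :=
  ∃ X : Set V, ∀ u v : V, D.Adj u v → (u ∈ X ∧ v ∈ Xᶜ) ∨ (u ∈ Xᶜ ∧ v ∈ X)

/-- The automorphism group of a digraph: the permutations of the vertex set that preserve
both arcs and non-arcs. -/
def Digraph.autGroup {V : Type*} (D : Digraph V) : Subgroup (Equiv.Perm V) where
  carrier := {σ | ∀ u v : V, D.Adj (σ u) (σ v) ↔ D.Adj u v}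
  mul_mem' := by
    intro σ τ hσ hτ u v
    exact (hσ (τ u) (τ v)).trans (hτ u v)
  one_mem' := fun _ _ => Iff.rfl
  inv_mem' := by
    intro σ hσ u v
    have h := hσ (σ⁻¹ u) (σ⁻¹ v)
    have e : ∀ x : V, σ (σ⁻¹ x) = x := fun x => σ.apply_symm_apply x
    rw [e, e] at h
    exact h.symm

/-- The Cayley digraph `Cay(G, S)`: vertex set `G`, with `(g, h)` an arc iff `g * h⁻¹ ∈ S`. -/
def cayleyDigraph {G : Type*} [Group G] (S : Set G) : Digraph G where
  Adj g h := g * h⁻¹ ∈ S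

/-- The image of `G` in `Equiv.Perm G` under its action on itself by right multiplication,
that is, the group of all permutations `x ↦ x * g`. -/
def rightRegular (G : Type*) [Group G] : Subgroup (Equiv.Perm G) :=
  (MulAction.toPermHom Gᵐᵒᵖ G).range

/-- `Cay(G, S)` is a DRR (digraphical regular representation): its automorphism group is `G`,
acting by right multiplication. -/
def IsDRR {G : Type*} [Group G] (S : Set G) : Prop :=
  (cayleyDigraph S).autGroup = rightRegular G

/-- The connection sets `S ⊆ G` for which `Cay(G, S)` is bipartite. -/
def bipartiteSets (G : Type*) [Group G] : Set (Set G) :=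
  {S | (cayleyDigraph S).IsBipartite}

/-- The connection sets `S ⊆ G` for which `Cay(G, S)` is a bipartite DRR. -/
def bipartiteDRRSets (G : Type*) [Group G] : Set (Set G) :=
  {S | (cayleyDigraph S).IsBipartite ∧ IsDRR S}

/-! A subgroup `B` of index 2 already gives `2 ^ (|A|/2)` bipartite connection sets, the subsets of
its complement. So it suffices to bound the bad sets by `2 ^ (31|A|/64)` times a factor `|A| ^ O(log
|A|)`, which pays for choosing the subgroups and automorphisms that witness badness.

A nonempty bipartite `S` lies in a coset of a proper subgroup. Sets in cosets of index at least 3,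
and sets that do not generate `A`, are few because they sit in small sets. Otherwise suppose that
the regular group `R` is proper in the automorphism group. If it is not self-normalizing there, a
nontrivial automorphism of `A` preserves `S`; it fixes at most half of `Bᶜ`, so few such `S` exist.

In the self-normalizing case take a minimal overgroup `H` of `R`. Conjugates of `R` in `H` other
than `R` meet `R` only in the center, so `[H : R] ≡ 1` modulo `[R : Z(H)]`. The transfer `H → R` is
then trivial modulo the center on a point stabilizer and the identity modulo the center on `R`.
Hence an element of the stabilizer of `1` moves each `a` by a central translation
(`exists_central_translation`), and on many cosets of the central translations `S` is invariant
under a nontrivial shift. Such sets are counted coset by coset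
(`ncard_locally_invariant_pow_mul_le`). -/

/-! ### Transfer into a self-normalizing maximal abelian subgroup -/

section MaximalAbelian

variable {H : Type*} [Group H] {R : Subgroup H}

/-- A maximal abelian subgroup `R` that is its own normalizer meets its other conjugates only in
the center. -/
theorem mem_center_of_conj_mem (hcomm : ∀ x ∈ R, ∀ y ∈ R, x * y = y * x) (hmax : IsCoatom R)
    (hself : ∀ g : H, (∀ x ∈ R, g * x * g⁻¹ ∈ R) → g ∈ R) {g x : H} (hg : g ∉ R)
    (hx : x ∈ R) (hgx : g⁻¹ * x * g ∈ R) : x ∈ Subgroup.center H := by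
  have hle : R ≤ Subgroup.centralizer {x} := fun y hy =>
    Subgroup.mem_centralizer_singleton_iff.mpr (hcomm y hy x hx)
  -- By maximality the centralizer of `x` is `R` or everything. If it is `R`, then `g` conjugates
  -- `R` into it, against self-normalization.
  rcases hle.eq_or_lt with h | h
  · refine absurd (hself g fun y hy => ?_) hg
    rw [h, Subgroup.mem_centralizer_singleton_iff]
    have e := hcomm y hy _ hgx
    calc g * y * g⁻¹ * x = g * (y * (g⁻¹ * x * g)) * g⁻¹ := by group
      _ = g * ((g⁻¹ * x * g) * y) * g⁻¹ := by rw [e]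
      _ = x * (g * y * g⁻¹) := by group
  · have h' := hmax.2 _ h
    rw [Subgroup.mem_center_iff]
    intro y
    have : y ∈ Subgroup.centralizer {x} := h' ▸ Subgroup.mem_top y
    exact Subgroup.mem_centralizer_singleton_iff.mp this

/-- Let `R` act on `H ⧸ R`: the base coset is fixed, and every other point has stabilizer exactly
the central part of `R`, so all other orbits have the same length. -/
theorem relIndex_center_dvd_index_sub_one [Finite H] (hcomm : ∀ x ∈ R, ∀ y ∈ R, x * y = y * x)
    (hmax : IsCoatom R) (hself : ∀ g : H, (∀ x ∈ R, g * x * g⁻¹ ∈ R) → g ∈ R) :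
    ∃ t, R.index = 1 + ((Subgroup.center H).subgroupOf R).index * t := by
  classical
  have := Fintype.ofFinite H
  have := Fintype.ofFinite (H ⧸ R)
  have := Fintype.ofFinite (MulAction.orbitRel.Quotient R (H ⧸ R))
  have hone : ∀ q : H ⧸ R, q = ((1 : H) : H ⧸ R) → (MulAction.stabilizer R q).index = 1 := by
    rintro q rfl
    rw [Subgroup.index_eq_one, eq_top_iff]
    intro x _
    rw [MulAction.mem_stabilizer_iff]
    change ((x.1 * 1 : H) : H ⧸ R) = _
    rw [QuotientGroup.eq]
    simp
  have hne : ∀ q : H ⧸ R, q ≠ ((1 : H) : H ⧸ R) →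
      MulAction.stabilizer R q = (Subgroup.center H).subgroupOf R := by
    intro q
    induction q using QuotientGroup.induction_on with
    | H g =>
      intro hq
      have hg : g⁻¹ ∉ R := fun h => hq (by rw [QuotientGroup.eq]; simpa using h)
      have hg' : g ∉ R := fun h => hg (R.inv_mem h)
      ext x
      rw [MulAction.mem_stabilizer_iff, Subgroup.mem_subgroupOf]
      have : x • (g : H ⧸ R) = ((x.1 * g : H) : H ⧸ R) := rfl
      rw [this, eq_comm, QuotientGroup.eq, ← mul_assoc]
      constructor
      · exact mem_center_of_conj_mem hcomm hmax hself hg' x.2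
      · intro hx
        rw [mul_assoc, ← Subgroup.mem_center_iff.mp hx g]
        simp
  have hsum : R.index = ∑ ω : MulAction.orbitRel.Quotient R (H ⧸ R),
      (MulAction.stabilizer R ω.out).index := by
    rw [Subgroup.index, Nat.card_congr (MulAction.selfEquivSigmaOrbits R (H ⧸ R)), Nat.card_sigma]
    refine Finset.sum_congr rfl fun ω _ => ?_
    rw [MulAction.index_stabilizer, Set.ncard]
    rfl
  set ω₀ : MulAction.orbitRel.Quotient R (H ⧸ R) := Quotient.mk'' ((1 : H) : H ⧸ R) with hω₀
  have hout : ω₀.out = ((1 : H) : H ⧸ R) := by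
    have h : MulAction.orbitRel R (H ⧸ R) ω₀.out ((1 : H) : H ⧸ R) := Quotient.mk_out _
    obtain ⟨x, hx⟩ := h
    rw [← hx]
    change ((x.1 * 1 : H) : H ⧸ R) = _
    rw [QuotientGroup.eq]
    simp
  have hout' : ∀ ω : MulAction.orbitRel.Quotient R (H ⧸ R), ω ≠ ω₀ →
      ω.out ≠ ((1 : H) : H ⧸ R) := by
    intro ω hω h
    apply hω
    rw [hω₀, ← h]
    exact (Quotient.out_eq' ω).symm
  rw [hsum, ← Finset.add_sum_erase _ _ (Finset.mem_univ ω₀), hone _ hout]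
  refine ⟨(Finset.univ.erase ω₀).card, ?_⟩
  rw [Finset.sum_congr rfl (g := fun _ => ((Subgroup.center H).subgroupOf R).index)]
  · simp [mul_comm]
  · intro ω hω
    rw [hne _ (hout' ω (Finset.ne_of_mem_erase hω))]

/-- If `P` has the order of the index of `R`, then `P` moves every coset of the center that is
contained in `R`, seen in the homogeneous space of `P`, to itself. -/
theorem mul_inv_mem_center_of_mul_eq_mul [Finite H] (hcomm : ∀ x ∈ R, ∀ y ∈ R, x * y = y * x)
    (hmax : IsCoatom R) (hself : ∀ g : H, (∀ x ∈ R, g * x * g⁻¹ ∈ R) → g ∈ R)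
    {P : Subgroup H} (hP : Nat.card P = R.index) {p p' r r' : H} (hp : p ∈ P) (hp' : p' ∈ P)
    (hr : r ∈ R) (hr' : r' ∈ R) (h : p * r = r' * p') : r' * r⁻¹ ∈ Subgroup.center H := by
  let _ : CommGroup R := { R.toGroup with
    mul_comm := fun a b => Subtype.ext (hcomm a a.2 b b.2) }
  obtain ⟨t, ht⟩ := relIndex_center_dvd_index_sub_one hcomm hmax hself
  set Z := (Subgroup.center H).subgroupOf R with hZ
  set V : H →* R := MonoidHom.transfer (MonoidHom.id R) with hV
  have hpow : ∀ x : R, x ^ R.index * x⁻¹ ∈ Z := by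
    intro x
    rw [ht, pow_add, pow_one, pow_mul, mul_comm, inv_mul_cancel_left]
    exact Z.pow_mem (Z.pow_index_mem x) t
  have hVR : ∀ x : H, (hx : x ∈ R) → V x * (⟨x, hx⟩ : R)⁻¹ ∈ Z := by
    intro x hx
    convert hpow ⟨x, hx⟩ using 2
    -- The transfer is the power map once no power of `x` has a different conjugate in `R`:
    -- conjugators inside `R` commute with it, and outside `R` the power is central.
    rw [hV, MonoidHom.transfer_eq_pow]
    · rfl
    · intro k g hk
      by_cases hg : g ∈ R
      · rw [mul_assoc, hcomm _ (R.pow_mem hx k) g hg, inv_mul_cancel_left]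
      · have hc := mem_center_of_conj_mem hcomm hmax hself hg (R.pow_mem hx k) hk
        rw [mul_assoc, ← Subgroup.mem_center_iff.mp hc g, inv_mul_cancel_left]
  -- `V x` is killed by `R.index`, while raising to `R.index` is the identity modulo `Z`.
  have hVP : ∀ x ∈ P, V x ∈ Z := by
    intro x hx
    have h1 : x ^ R.index = 1 := by
      rw [← hP]
      exact congrArg Subtype.val (pow_card_eq_one' (x := (⟨x, hx⟩ : P)))
    have h2 := hpow (V x)
    rw [← map_pow, h1, map_one, one_mul] at h2
    simpa using h2
  have e : V p * V r = V r' * V p' := by rw [← map_mul, h, map_mul]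
  have key : (⟨r', hr'⟩ : R) * (⟨r, hr⟩ : R)⁻¹ ∈ Z := by
    have h1 := Z.mul_mem (Z.mul_mem (Z.inv_mem (hVR r' hr')) (hVR r hr))
      (Z.mul_mem (hVP p hp) (Z.inv_mem (hVP p' hp')))
    convert h1 using 1
    have e' : V p = V r' * V p' * (V r)⁻¹ := by rw [← e]; group
    rw [e']
    generalize (⟨r', hr'⟩ : R) = a
    generalize (⟨r, hr⟩ : R) = b
    have : ∀ v w u : R, a / b = (v / a)⁻¹ * (w / b) * (v * u / w / u) := by
      intro v w u
      exact (show ∀ a b v w u : Additive R, a - b = -(v - a) + (w - b) + (v + u - w - u) from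
        fun a b v w u => by abel) (.ofMul a) (.ofMul b) (.ofMul v) (.ofMul w) (.ofMul u)
    simpa only [div_eq_mul_inv] using this _ _ _
  simpa [hZ, Subgroup.mem_subgroupOf] using key

end MaximalAbelian

/-! ### Automorphisms of Cayley digraphs -/

theorem mem_rightRegular {G : Type*} [Group G] {σ : Equiv.Perm G} :
    σ ∈ rightRegular G ↔ ∃ g : G, σ = Equiv.mulRight g := by
  constructor
  · rintro ⟨g, rfl⟩
    exact ⟨g.unop, Equiv.ext fun x => rfl⟩
  · rintro ⟨g, rfl⟩
    exact ⟨MulOpposite.op g, Equiv.ext fun x => rfl⟩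

theorem mulRight_mem_rightRegular {G : Type*} [Group G] (g : G) :
    Equiv.mulRight g ∈ rightRegular G :=
  mem_rightRegular.mpr ⟨g, rfl⟩

theorem mem_autGroup_cayleyDigraph {G : Type*} [Group G] {S : Set G} {σ : Equiv.Perm G} :
    σ ∈ (cayleyDigraph S).autGroup ↔ ∀ u v, σ u * (σ v)⁻¹ ∈ S ↔ u * v⁻¹ ∈ S :=
  Iff.rfl

theorem rightRegular_le_autGroup {G : Type*} [Group G] (S : Set G) :
    rightRegular G ≤ (cayleyDigraph S).autGroup := by
  intro σ hσ
  obtain ⟨g, rfl⟩ := mem_rightRegular.mp hσ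
  rw [mem_autGroup_cayleyDigraph]
  intro u v
  simp

section

variable {A : Type*} [CommGroup A]

/-- If the regular group of `A` is maximal in `H` and self-normalizing in `H`, the elements of `H`
fixing `1` act by multiplication by elements of `A` that are central in `H`. -/
theorem exists_central_translation [Finite A] {H : Subgroup (Equiv.Perm A)} (hcov : rightRegular A ⋖ H)
    (hself : ∀ σ ∈ H, (∀ τ ∈ rightRegular A, σ * τ * σ⁻¹ ∈ rightRegular A) → σ ∈ rightRegular A)
    {φ : Equiv.Perm A} (hφ : φ ∈ H) (hφ1 : φ 1 = 1) (a : A) :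
    ∃ w, φ a = a * w ∧ ∀ σ ∈ H, ∀ x, σ (x * w) = σ x * w := by
  set R : Subgroup H := (rightRegular A).subgroupOf H with hR
  have hle : rightRegular A ≤ H := hcov.le
  have hmulR : ∀ g : A, Equiv.mulRight g ∈ H := fun g => hle (mulRight_mem_rightRegular g)
  have hcomm : ∀ x ∈ R, ∀ y ∈ R, x * y = y * x := by
    rintro ⟨x, hx⟩ hx' ⟨y, hy⟩ hy'
    rw [hR, Subgroup.mem_subgroupOf] at hx' hy'
    obtain ⟨g, rfl⟩ := mem_rightRegular.mp hx'
    obtain ⟨h, rfl⟩ := mem_rightRegular.mp hy'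
    ext z
    simp [mul_right_comm]
  have hmax : IsCoatom R := by
    refine ⟨fun h => ?_, fun K hK => ?_⟩
    · rw [hR, Subgroup.subgroupOf_eq_top] at h
      exact hcov.lt.not_ge h
    · have h1 : rightRegular A < K.map H.subtype := by
        rw [← Subgroup.map_subgroupOf_eq_of_le hle]
        exact (Subgroup.map_lt_map_iff_of_injective H.subtype_injective).mpr hK
      have h2 : K.map H.subtype ≤ H := by
        rintro _ ⟨x, _, rfl⟩
        exact x.2
      have h3 := h2.eq_of_not_lt (hcov.2 h1)
      rw [eq_top_iff]
      intro x _
      have hx : (x : Equiv.Perm A) ∈ K.map H.subtype := by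
        rw [h3]
        exact x.2
      obtain ⟨y, hy, hyx⟩ := hx
      rwa [← Subtype.ext (a1 := y) (a2 := x) hyx]
  have hself' : ∀ g : H, (∀ x ∈ R, g * x * g⁻¹ ∈ R) → g ∈ R := by
    intro g hg
    rw [hR, Subgroup.mem_subgroupOf]
    exact hself g g.2 fun τ hτ => hg ⟨τ, hle hτ⟩ hτ
  -- `H` is transitive because it contains the translations, so orbit-stabilizer applies.
  have hP : Nat.card (MulAction.stabilizer H (1 : A)) = R.index := by
    have h1 : Nat.card (MulAction.orbit H (1 : A)) = Nat.card A := by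
      rw [Nat.card_congr (Equiv.subtypeUnivEquiv _)]
      intro a
      exact ⟨⟨Equiv.mulRight a, hmulR a⟩, one_mul a⟩
    have h2 : Nat.card R = Nat.card A := by
      rw [hR, Nat.card_congr (Subgroup.subgroupOfEquivOfLe hle).toEquiv]
      refine (Nat.card_congr (Equiv.ofBijective
        (fun a : A => (⟨Equiv.mulRight a, mulRight_mem_rightRegular a⟩ : rightRegular A))
        ⟨fun a b hab => ?_, fun ⟨τ, hτ⟩ => ?_⟩)).symm
      · simpa using congrArg (fun τ : rightRegular A => τ.1 1) hab
      · obtain ⟨g, rfl⟩ := mem_rightRegular.mp hτ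
        exact ⟨g, rfl⟩
    have h3 := Nat.card_congr (MulAction.orbitProdStabilizerEquivGroup H (1 : A))
    rw [Nat.card_prod, h1, ← R.card_mul_index, h2] at h3
    exact Nat.eq_of_mul_eq_mul_left Nat.card_pos h3
  set r : H := ⟨Equiv.mulRight a, hmulR a⟩ with hr
  set r' : H := ⟨Equiv.mulRight (φ a), hmulR _⟩ with hr'
  set p : H := ⟨φ, hφ⟩ with hp
  have hpP : p ∈ MulAction.stabilizer H (1 : A) := hφ1
  have hpP' : r'⁻¹ * p * r ∈ MulAction.stabilizer H (1 : A) := by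
    rw [MulAction.mem_stabilizer_iff, mul_smul, mul_smul, inv_smul_eq_iff]
    change φ (1 * a) = 1 * φ a
    simp
  have hc := mul_inv_mem_center_of_mul_eq_mul hcomm hmax hself' hP hpP hpP'
    (r := r) (r' := r') (mulRight_mem_rightRegular a) (mulRight_mem_rightRegular _) (by group)
  refine ⟨φ a * a⁻¹, by rw [mul_comm, inv_mul_cancel_right], fun σ hσ x => ?_⟩
  have h1 := Subgroup.mem_center_iff.mp hc ⟨σ, hσ⟩
  have h2 := congrArg (fun τ : H => (τ : Equiv.Perm A) x) h1
  have e : ∀ y, ((r' * r⁻¹ : H) : Equiv.Perm A) y = y * (φ a * a⁻¹) := by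
    intro y
    change (Equiv.mulRight (φ a)) ((Equiv.mulRight a)⁻¹ y) = _
    simp [mul_comm, mul_assoc]
  have h3 : σ (((r' * r⁻¹ : H) : Equiv.Perm A) x) = ((r' * r⁻¹ : H) : Equiv.Perm A) (σ x) := h2
  rwa [e, e] at h3

/-- The automorphism group of a connected Cayley digraph preserves every bipartition. -/
theorem apply_mul_inv_mem_of_fixes_one {S : Set A} {B : Subgroup A} (hB : B.index = 2)
    (hSB : ∀ s ∈ S, s ∉ B) (hS : Subgroup.closure S = ⊤) {φ : Equiv.Perm A}
    (hφ : φ ∈ (cayleyDigraph S).autGroup) (hφ1 : φ 1 = 1) (a : A) : φ a * a⁻¹ ∈ B := by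
  -- The displacement modulo `B` is constant along arcs, since `s` and `φ (s * x) * (φ x)⁻¹` both
  -- lie in the nontrivial coset of `B`.
  let f : A → A := fun x => φ x * x⁻¹
  have key : ∀ c ∈ Subgroup.closure S, ∀ x, f (c * x) * (f x)⁻¹ ∈ B := by
    intro c hc
    induction hc using Subgroup.closure_induction with
    | mem s hs =>
      intro x
      have h1 : φ (s * x) * (φ x)⁻¹ ∈ S := by
        rw [mem_autGroup_cayleyDigraph.mp hφ]
        simpa using hs
      have h2 := (Subgroup.mul_mem_iff_of_index_two hB (a := φ (s * x) * (φ x)⁻¹)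
        (b := s⁻¹)).mpr
        ⟨fun h => absurd h (hSB _ h1), fun h => absurd (B.inv_mem_iff.mp h) (hSB _ hs)⟩
      convert h2 using 1
      simp only [f, mul_inv_rev, inv_inv]
      rw [mul_assoc, mul_assoc, mul_assoc, mul_left_comm s⁻¹ x, inv_mul_cancel_left,
        mul_comm s⁻¹]
    | one =>
      intro x
      simp [B.one_mem]
    | mul c d _ _ hc hd =>
      intro x
      have := B.mul_mem (hc (d * x)) (hd x)
      simpa [mul_assoc] using this
    | inv c _ hc =>
      intro x
      have := B.inv_mem (hc (c⁻¹ * x))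
      simpa using this
  have := key a (hS ▸ Subgroup.mem_top a) 1
  simpa [f, hφ1] using this

/-- A connected bipartite Cayley digraph that is not a DRR either has a nontrivial group
automorphism fixing its connection set, or its connection set is, on many cosets of a subgroup `Z`,
invariant under nontrivial translations. -/
theorem exists_mulEquiv_or_exists_local_translation [Finite A] {S : Set A} {B : Subgroup A}
    (hB : B.index = 2) (hSB : ∀ s ∈ S, s ∉ B) (hS : Subgroup.closure S = ⊤) (hD : ¬ IsDRR S) :
    (∃ φ : A ≃* A, φ ≠ 1 ∧ ∀ x, φ x ∈ S ↔ x ∈ S) ∨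
    ∃ Z M : Subgroup A, Z ≤ B ∧ Z ≤ M ∧ M ≠ ⊤ ∧
      ∀ a ∉ M, ∃ w ∈ Z, w ≠ 1 ∧ ∀ z ∈ Z, a * w * z ∈ S ↔ a * z ∈ S := by
  by_cases hself : ∀ σ ∈ (cayleyDigraph S).autGroup,
      (∀ τ ∈ rightRegular A, σ * τ * σ⁻¹ ∈ rightRegular A) → σ ∈ rightRegular A
  · right
    have hlt : rightRegular A < (cayleyDigraph S).autGroup :=
      lt_of_le_of_ne (rightRegular_le_autGroup S) (Ne.symm hD)
    -- A minimal overgroup makes the regular group maximal, as the transfer argument requires.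
    obtain ⟨H, hcov, hH⟩ := exists_covBy_le_of_lt hlt
    have htr := fun φ hφ hφ1 a => exists_central_translation hcov
      (fun σ hσ => hself σ (hH hσ)) (φ := φ) hφ hφ1 a
    have hmulR : ∀ g : A, Equiv.mulRight g ∈ H :=
      fun g => hcov.le (mulRight_mem_rightRegular g)
    let Z : Subgroup A :=
      { carrier := {w | ∀ σ ∈ H, ∀ x, σ (x * w) = σ x * w}
        one_mem' := fun σ _ x => by simp
        mul_mem' := fun {v w} hv hw σ hσ x => by
          rw [← mul_assoc, hw σ hσ, hv σ hσ, mul_assoc]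
        inv_mem' := fun {w} hw σ hσ x => by
          rw [eq_mul_inv_iff_mul_eq, ← hw σ hσ, inv_mul_cancel_right] }
    -- The points fixed by the whole stabilizer of `1`; conjugating by translations shows that they
    -- form a subgroup.
    let M : Subgroup A :=
      { carrier := {a | ∀ φ ∈ H, φ 1 = 1 → φ a = a}
        one_mem' := fun φ _ h => h
        mul_mem' := fun {a b} ha hb φ hφ hφ1 => by
          have h1 : (Equiv.mulRight b)⁻¹ * φ * Equiv.mulRight b ∈ H :=
            H.mul_mem (H.mul_mem (H.inv_mem (hmulR b)) hφ) (hmulR b)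
          have h2 := ha _ h1 (by simp [hb φ hφ hφ1])
          simpa [mul_inv_eq_iff_eq_mul] using h2
        inv_mem' := fun {b} hb φ hφ hφ1 => by
          have h1 : (Equiv.mulRight (φ b⁻¹))⁻¹ * φ * Equiv.mulRight b⁻¹ ∈ H :=
            H.mul_mem (H.mul_mem (H.inv_mem (hmulR _)) hφ) (hmulR _)
          have h2 := hb _ h1 (by simp)
          simp only [Equiv.Perm.mul_apply, Equiv.coe_mulRight, mul_inv_cancel, hφ1,
            Equiv.Perm.inv_def, Equiv.mulRight_symm_apply, one_mul] at h2
          exact inv_eq_iff_eq_inv.mp h2 }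
    have hM : M ≠ ⊤ := by
      intro h
      refine hcov.lt.not_ge fun σ hσ => mem_rightRegular.mpr ⟨σ 1, ?_⟩
      ext a
      have h1 : (Equiv.mulRight (σ 1))⁻¹ * σ ∈ H := H.mul_mem (H.inv_mem (hmulR _)) hσ
      have ha : a ∈ M := h ▸ Subgroup.mem_top a
      have h2 := ha _ h1 (by simp)
      simpa [mul_inv_eq_iff_eq_mul] using h2
    -- Cutting down to `B` loses nothing, as displacements lie in `B`; it keeps cosets inside one
    -- part of the bipartition.
    refine ⟨Z ⊓ B, M, inf_le_right, ?_, hM, ?_⟩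
    · intro z hz φ hφ hφ1
      have := hz.1 φ hφ 1
      simpa [hφ1] using this
    · intro a ha
      have ha' : ¬ ∀ φ ∈ H, φ 1 = 1 → φ a = a := ha
      push Not at ha'
      obtain ⟨φ, hφ, hφ1, hne⟩ := ha'
      obtain ⟨w, hw, hwZ⟩ := htr φ hφ hφ1 a
      have hwB := apply_mul_inv_mem_of_fixes_one hB hSB hS (hH hφ) hφ1 a
      rw [hw, mul_comm a w, mul_inv_cancel_right] at hwB
      refine ⟨w, ⟨hwZ, hwB⟩, fun h => hne (by simp [hw, h]), fun z hz => ?_⟩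
      have h1 := mem_autGroup_cayleyDigraph.mp (hH hφ) (a * z) 1
      rw [hz.1 φ hφ a, hw, hφ1] at h1
      simpa using h1
  · left
    push Not at hself
    obtain ⟨σ, hσ, hnorm, hnot⟩ := hself
    set φ : Equiv.Perm A := (Equiv.mulRight (σ 1))⁻¹ * σ with hφ
    have hφ1 : φ 1 = 1 := by simp [hφ]
    have hφG : φ ∈ (cayleyDigraph S).autGroup :=
      Subgroup.mul_mem _ (Subgroup.inv_mem _
        (rightRegular_le_autGroup S (mulRight_mem_rightRegular _))) hσ
    -- A permutation that normalizes the translations and fixes `1` is a group automorphism.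
    have hmul : ∀ x y, φ (x * y) = φ x * φ y := by
      intro x y
      obtain ⟨c, hc⟩ := mem_rightRegular.mp (hnorm _ (mulRight_mem_rightRegular y))
      have hc' : ∀ x, σ (x * y) = σ x * c := by
        intro x
        have := congrArg (fun τ : Equiv.Perm A => τ (σ x)) hc
        simpa using this
      have h1 := hc' 1
      rw [one_mul] at h1
      simp only [hφ, Equiv.Perm.mul_apply, Equiv.Perm.inv_def, Equiv.mulRight_symm_apply, hc', h1]
      rw [mul_comm (σ 1) c, mul_inv_cancel_right, mul_right_comm]
    refine ⟨MulEquiv.mk' φ hmul, ?_, ?_⟩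
    · intro h
      apply hnot
      refine mem_rightRegular.mpr ⟨σ 1, Equiv.ext fun x => ?_⟩
      have h1 : φ x = x := DFunLike.congr_fun h x
      simpa [hφ, mul_inv_eq_iff_eq_mul] using h1
    · intro x
      have h1 : φ x ∈ S ↔ x ∈ S := by
        simpa [hφ1] using mem_autGroup_cayleyDigraph.mp hφG x 1
      exact h1

end

/-! ### Counting invariant subsets -/

open scoped Pointwise in
/-- The number of subsets of `T` invariant under a permutation `φ`, in terms of the number of
fixed points of `φ` in `T`. -/
theorem ncard_invariant_subsets_sq_le {X : Type*} [Finite X] (φ : Equiv.Perm X) (T : Set X) :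
    {S : Set X | S ⊆ T ∧ ∀ x, φ x ∈ S ↔ x ∈ S}.ncard ^ 2 ≤
      2 ^ (T.ncard + (T ∩ {x | φ x = x}).ncard) := by
  let r : Setoid X := Equiv.Perm.SameCycle.setoid φ
  let rep : X → X := fun x => (Quotient.mk r x).out
  have hrep : ∀ x, φ.SameCycle (rep x) x := fun x => Quotient.mk_out (s := r) x
  have hrep_eq : ∀ x y, φ.SameCycle x y → rep x = rep y := fun x y h =>
    congrArg Quotient.out (Quotient.sound (s := r) h)
  have hconst : ∀ S : Set X, (∀ x, φ x ∈ S ↔ x ∈ S) → ∀ x, rep x ∈ S ↔ x ∈ S := by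
    intro S hS x
    obtain ⟨i, hi⟩ := hrep x
    have h1 : φ ∈ MulAction.stabilizer (Equiv.Perm X) S := MulAction.mem_stabilizer_set.mpr hS
    have h2 := MulAction.mem_stabilizer_set.mp (Subgroup.zpow_mem _ h1 i) (rep x)
    rw [Equiv.Perm.smul_def, hi] at h2
    exact h2.symm
  -- An invariant `S ⊆ T` is determined by its cycle representatives, all of which lie in `O`. The
  -- images of the non-fixed ones are further points of `T` outside `O`.
  set O : Set X := {x | rep x = x ∧ x ∈ T ∧ φ x ∈ T} with hO
  have hle : {S : Set X | S ⊆ T ∧ ∀ x, φ x ∈ S ↔ x ∈ S}.ncard ≤ 2 ^ O.ncard := by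
    rw [← Set.ncard_powerset]
    refine Set.ncard_le_ncard_of_injOn (fun S => S ∩ O) (fun S _ => Set.inter_subset_right) ?_
      (Set.toFinite _)
    rintro S ⟨hST, hS⟩ S' ⟨hST', hS'⟩ h
    have hmem : ∀ S : Set X, S ⊆ T → (∀ x, φ x ∈ S ↔ x ∈ S) → ∀ x, x ∈ S ↔ rep x ∈ S ∩ O := by
      intro S hST hS x
      rw [← hconst S hS x]
      refine ⟨fun hx => ⟨hx, hrep_eq _ _ (hrep x), hST hx, hST ((hS _).mpr hx)⟩, fun hx => hx.1⟩
    ext x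
    rw [hmem S hST hS, hmem S' hST' hS']
    exact iff_of_eq (congrArg (rep x ∈ ·) h)
  have hcard : O.ncard + O.ncard ≤ T.ncard + (T ∩ {x | φ x = x}).ncard := by
    have h1 : (O ∩ {x | φ x = x}).ncard + (O \ {x | φ x = x}).ncard = O.ncard :=
      Set.ncard_inter_add_ncard_sdiff_eq_ncard _ _ (Set.toFinite _)
    have h2 : (O ∩ {x | φ x = x}).ncard ≤ (T ∩ {x | φ x = x}).ncard :=
      Set.ncard_le_ncard (fun x hx => ⟨hx.1.2.1, hx.2⟩) (Set.toFinite _)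
    have h3 : (φ '' (O \ {x | φ x = x})).ncard = (O \ {x | φ x = x}).ncard :=
      Set.ncard_image_of_injective _ φ.injective
    have h4 : Disjoint O (φ '' (O \ {x | φ x = x})) := by
      rw [Set.disjoint_left]
      rintro _ hx ⟨y, hy, rfl⟩
      apply hy.2
      have := hrep_eq (φ y) y ⟨-1, by simp⟩
      rw [hx.1, hy.1.1] at this
      exact this
    have h5 : (O ∪ φ '' (O \ {x | φ x = x})).ncard ≤ T.ncard := by
      refine Set.ncard_le_ncard ?_ (Set.toFinite _)
      rintro x (hx | ⟨y, hy, rfl⟩)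
      · exact hx.2.1
      · exact hy.1.2.2
    rw [Set.ncard_union_eq h4 (Set.toFinite _) (Set.toFinite _)] at h5
    omega
  calc _ ≤ (2 ^ O.ncard) ^ 2 := Nat.pow_le_pow_left hle 2
    _ = 2 ^ (O.ncard + O.ncard) := by rw [← pow_mul, mul_two]
    _ ≤ _ := Nat.pow_le_pow_right two_pos hcard

/-- Absorbs the choice of a translation: with `j = |Z| - 1`, it turns `j * 2 ^ (|Z|/2)` into `2 ^
(15|Z|/16)`. From `j = 3` on the induction works since `(4/3) ^ 16 < 128`. -/
theorem pow_sixteen_le_two_pow (j : ℕ) : j ^ 16 ≤ 2 ^ (7 * (j + 1)) := by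
  rcases lt_or_ge j 3 with h | h
  · interval_cases j <;> norm_num
  · induction j, h using Nat.le_induction with
    | base => norm_num
    | succ j hj ih =>
      have h1 : 3 * (j + 1) ≤ 4 * j := by omega
      have h2 := Nat.pow_le_pow_left h1 16
      rw [mul_pow, mul_pow] at h2
      have h3 : 2 ^ (7 * (j + 1 + 1)) = 128 * 2 ^ (7 * (j + 1)) := by
        rw [show 7 * (j + 1 + 1) = 7 + 7 * (j + 1) by ring, pow_add]
        norm_num
      rw [h3]
      norm_num at h2
      omega

theorem ncard_iUnion_le_card_mul {ι X : Type*} [Finite ι] [Finite X] (f : ι → Set X) {c : ℝ}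
    (hf : ∀ i, ((f i).ncard : ℝ) ≤ c) : ((⋃ i, f i).ncard : ℝ) ≤ Nat.card ι * c := by
  classical
  have := Fintype.ofFinite ι
  have := Fintype.ofFinite X
  have h : (⋃ i, f i).ncard ≤ ∑ i, (f i).ncard := by
    simp only [Set.ncard_eq_toFinset_card']
    have : (⋃ i, f i).toFinset = Finset.univ.biUnion fun i => (f i).toFinset := by
      ext x
      simp
    rw [this]
    exact Finset.card_biUnion_le
  calc ((⋃ i, f i).ncard : ℝ) ≤ ∑ i, ((f i).ncard : ℝ) := by exact_mod_cast h
    _ ≤ ∑ _i : ι, c := Finset.sum_le_sum fun i _ => hf i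
    _ = _ := by simp

/-- Few subsets of a finite group are invariant under a nontrivial translation. -/
theorem ncard_translation_invariant_pow_le (Z : Type*) [Group Z] [Finite Z] :
    {U : Set Z | ∃ w : Z, w ≠ 1 ∧ ∀ z, w * z ∈ U ↔ z ∈ U}.ncard ^ 16 ≤ 2 ^ (15 * Nat.card Z) := by
  set c := Nat.sqrt (2 ^ Nat.card Z) with hc
  have hcard : Nat.card {w : Z // w ≠ 1} = Nat.card Z - 1 := by
    have := Set.ncard_compl ({1} : Set Z)
    rw [Set.ncard_singleton] at this
    rw [← this]
    rfl
  have h1 : {U : Set Z | ∃ w : Z, w ≠ 1 ∧ ∀ z, w * z ∈ U ↔ z ∈ U}.ncard ≤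
      (Nat.card Z - 1) * c := by
    have : {U : Set Z | ∃ w : Z, w ≠ 1 ∧ ∀ z, w * z ∈ U ↔ z ∈ U} =
        ⋃ w : {w : Z // w ≠ 1}, {U : Set Z | ∀ z, w.1 * z ∈ U ↔ z ∈ U} := by
      ext U
      simp
    have h2 := ncard_iUnion_le_card_mul
      (fun w : {w : Z // w ≠ 1} => {U : Set Z | ∀ z, w.1 * z ∈ U ↔ z ∈ U}) (c := c) ?_
    · rw [← this, hcard] at h2
      exact_mod_cast h2
    · rintro ⟨w, hw⟩
      rw [Nat.cast_le, hc, Nat.le_sqrt']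
      have h3 := ncard_invariant_subsets_sq_le (Equiv.mulLeft w) Set.univ
      have h4 : {x : Z | (Equiv.mulLeft w) x = x} = ∅ := by
        ext x
        simpa using hw
      rw [h4] at h3
      simpa [Set.ncard_univ] using h3
  have h2 : c ^ 16 ≤ 2 ^ (8 * Nat.card Z) := by
    have := Nat.pow_le_pow_left (Nat.sqrt_le' (2 ^ Nat.card Z)) 8
    rw [← pow_mul, ← pow_mul, mul_comm (Nat.card Z) 8] at this
    exact this
  have hpos : 0 < Nat.card Z := Nat.card_pos
  calc _ ≤ ((Nat.card Z - 1) * c) ^ 16 := Nat.pow_le_pow_left h1 16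
    _ = (Nat.card Z - 1) ^ 16 * c ^ 16 := mul_pow _ _ _
    _ ≤ 2 ^ (7 * (Nat.card Z - 1 + 1)) * 2 ^ (8 * Nat.card Z) :=
      Nat.mul_le_mul (pow_sixteen_le_two_pow _) h2
    _ = 2 ^ (15 * Nat.card Z) := by
      rw [← pow_add]
      congr 1
      omega

/-- Few subsets of `T` are, on each coset of `Z` contained in `D`, invariant under some nontrivial
translation by an element of `Z`. -/
theorem ncard_locally_invariant_pow_mul_le {A : Type*} [CommGroup A] [Finite A] (Z : Subgroup A)
    {T D : Set A} (hDT : D ⊆ T) (hD : ∀ a ∈ D, ∀ z ∈ Z, a * z ∈ D) :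
    {S : Set A | S ⊆ T ∧ ∀ a ∈ D, ∃ w ∈ Z, w ≠ 1 ∧
      ∀ z ∈ Z, a * w * z ∈ S ↔ a * z ∈ S}.ncard ^ 16 * 2 ^ D.ncard ≤ 2 ^ (16 * T.ncard) := by
  set 𝒮 := {S : Set A | S ⊆ T ∧ ∀ a ∈ D, ∃ w ∈ Z, w ≠ 1 ∧ ∀ z ∈ Z, a * w * z ∈ S ↔ a * z ∈ S}
  set 𝒰 := {U : Set Z | ∃ w : Z, w ≠ 1 ∧ ∀ z, w * z ∈ U ↔ z ∈ U}
  let D' : Set (A ⧸ Z) := {q | q.out ∈ D}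
  have hgood : ∀ S : 𝒮, ∀ q : D', {z : Z | q.1.out * z ∈ S.1} ∈ 𝒰 := by
    rintro ⟨S, hS⟩ ⟨q, hq⟩
    obtain ⟨w, hw, hw1, h⟩ := hS.2 _ hq
    refine ⟨⟨w, hw⟩, fun h' => hw1 (congrArg Subtype.val h'), fun z => ?_⟩
    simpa [mul_assoc] using h z z.2
  -- Encode `S` by its trace off `D` and its traces on the cosets of `Z` inside `D`.
  let f : 𝒮 → (𝒫 (T \ D)) × (D' → 𝒰) := fun S =>
    (⟨S.1 \ D, Set.sdiff_subset_sdiff_left S.2.1⟩, fun q => ⟨_, hgood S q⟩)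
  have hf : Function.Injective f := by
    rintro S S' h
    have h1 : S.1 \ D = S'.1 \ D := congrArg Subtype.val (congrArg Prod.fst h)
    have h2 : ∀ q : D', {z : Z | q.1.out * z ∈ S.1} = {z : Z | q.1.out * z ∈ S'.1} := fun q =>
      congrArg Subtype.val (congrFun (congrArg Prod.snd h) q)
    ext x
    by_cases hx : x ∈ D
    · obtain ⟨z, hz⟩ := QuotientGroup.mk_out_eq_mul Z x
      have hq : ((x : A ⧸ Z)) ∈ D' := by
        change (x : A ⧸ Z).out ∈ D
        rw [hz]
        exact hD x hx z z.2
      have h3 := Set.ext_iff.mp (h2 ⟨_, hq⟩) z⁻¹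
      simpa [hz] using h3
    · have h3 := Set.ext_iff.mp h1 x
      simpa [hx] using h3
  have hcard : 𝒮.ncard ≤ 2 ^ (T \ D).ncard * 𝒰.ncard ^ D'.ncard := by
    have h1 := Nat.card_le_card_of_injective f hf
    rw [Nat.card_prod, Nat.card_fun] at h1
    rw [Nat.card_coe_set_eq, Nat.card_coe_set_eq, Nat.card_coe_set_eq, Nat.card_coe_set_eq,
      Set.ncard_powerset _ (Set.toFinite _)] at h1
    exact h1
  have hD' : D'.ncard * Nat.card Z ≤ D.ncard := by
    let g : D' × Z → D := fun p => ⟨p.1.1.out * p.2, hD _ p.1.2 _ p.2.2⟩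
    have hg : Function.Injective g := by
      rintro ⟨⟨q, hq⟩, z⟩ ⟨⟨q', hq'⟩, z'⟩ h
      have h1 : q.out * z = q'.out * z' := congrArg Subtype.val h
      have h2 : q = q' := by
        have := congrArg (QuotientGroup.mk (s := Z)) h1
        simpa using this
      subst h2
      simpa using h1
    have := Nat.card_le_card_of_injective g hg
    rwa [Nat.card_prod, Nat.card_coe_set_eq, Nat.card_coe_set_eq] at this
  have hTD : (T \ D).ncard + D.ncard = T.ncard :=
    Set.ncard_sdiff_add_ncard_of_subset hDT (Set.toFinite _)
  calc 𝒮.ncard ^ 16 * 2 ^ D.ncard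
      ≤ (2 ^ (T \ D).ncard * 𝒰.ncard ^ D'.ncard) ^ 16 * 2 ^ D.ncard :=
        Nat.mul_le_mul_right _ (Nat.pow_le_pow_left hcard 16)
    _ = 2 ^ ((T \ D).ncard * 16) * (𝒰.ncard ^ 16) ^ D'.ncard * 2 ^ D.ncard := by ring
    _ ≤ 2 ^ ((T \ D).ncard * 16) * (2 ^ (15 * Nat.card Z)) ^ D'.ncard * 2 ^ D.ncard := by
        exact Nat.mul_le_mul_right _ (Nat.mul_le_mul_left _
          (Nat.pow_le_pow_left (ncard_translation_invariant_pow_le Z) _))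
    _ = 2 ^ ((T \ D).ncard * 16 + 15 * (D'.ncard * Nat.card Z) + D.ncard) := by
        rw [← pow_mul, ← pow_add, ← pow_add]
        congr 2
        ring
    _ ≤ 2 ^ (16 * T.ncard) := Nat.pow_le_pow_right two_pos (by omega)

/-! ### Numbers of subgroups and automorphisms -/

section Generators

variable {A : Type*} [Group A] [Finite A]

/-- Each generator taken outside the current subgroup at least doubles its order; the strict bound
with exponent `k + 1` leaves room for only `k` doublings. -/
theorem exists_closure_range_sup_eq (k : ℕ) : ∀ {K H : Subgroup A}, K ≤ H →
    Nat.card H < 2 ^ (k + 1) * Nat.card K →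
      ∃ f : Fin k → A, Subgroup.closure (Set.range f) ⊔ K = H := by
  induction k with
  | zero =>
    intro K H hKH hlt
    refine ⟨Fin.elim0, ?_⟩
    have h : K = H := by
      by_contra hne
      have h1 := Subgroup.card_mul_index (K.subgroupOf H)
      rw [Nat.card_congr (Subgroup.subgroupOfEquivOfLe hKH).toEquiv] at h1
      have h2 : (K.subgroupOf H).index ≠ 1 := by
        rw [Ne, Subgroup.index_eq_one, Subgroup.subgroupOf_eq_top]
        exact fun h => hne (le_antisymm hKH h)
      have h3 : (K.subgroupOf H).index ≠ 0 := Subgroup.index_ne_zero_of_finite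
      have : 2 * Nat.card K ≤ Nat.card H := by
        rw [← h1, mul_comm]
        exact Nat.mul_le_mul_left _ (by omega)
      omega
    simp [h]
  | succ k ih =>
    intro K H hKH hlt
    by_cases hne : H ≤ K
    · refine ⟨fun _ => 1, le_antisymm (sup_le ?_ hKH) (hne.trans le_sup_right)⟩
      rw [Subgroup.closure_le]
      rintro _ ⟨_, rfl⟩
      exact H.one_mem
    · obtain ⟨h, hH, hK⟩ := SetLike.not_le_iff_exists.mp hne
      set L := Subgroup.zpowers h ⊔ K with hL
      have hKL : K ≤ L := le_sup_right
      have hhL : h ∈ L := (le_sup_left : _ ≤ L) (Subgroup.mem_zpowers h)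
      have hLH : L ≤ H := sup_le (Subgroup.zpowers_le.mpr hH) hKH
      have h1 := Subgroup.card_mul_index (K.subgroupOf L)
      rw [Nat.card_congr (Subgroup.subgroupOfEquivOfLe hKL).toEquiv] at h1
      have h2 : (K.subgroupOf L).index ≠ 1 := by
        rw [Ne, Subgroup.index_eq_one, Subgroup.subgroupOf_eq_top]
        exact fun h => hK (h hhL)
      have h3 : (K.subgroupOf L).index ≠ 0 := Subgroup.index_ne_zero_of_finite
      have h4 : 2 * Nat.card K ≤ Nat.card L := by
        rw [← h1, mul_comm]
        exact Nat.mul_le_mul_left _ (by omega)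
      obtain ⟨f, hf⟩ := ih hLH (by
        calc _ < _ := hlt
          _ = 2 ^ (k + 1) * (2 * Nat.card K) := by ring
          _ ≤ _ := Nat.mul_le_mul_left _ h4)
      refine ⟨Fin.cons h f, ?_⟩
      rw [Fin.range_cons, Set.insert_eq, Subgroup.closure_union, ← Subgroup.zpowers_eq_closure,
        ← hf, hL]
      ac_rfl

/-- A finite group of order `n` is generated by `log₂ n` elements. -/
theorem exists_closure_range_eq (H : Subgroup A) :
    ∃ f : Fin (Nat.log 2 (Nat.card A)) → A, Subgroup.closure (Set.range f) = H := by
  obtain ⟨f, hf⟩ := exists_closure_range_sup_eq (Nat.log 2 (Nat.card A)) (bot_le (a := H)) (by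
    rw [Subgroup.card_bot, mul_one]
    exact (Subgroup.card_le_card_group H).trans_lt (Nat.lt_pow_succ_log_self one_lt_two _))
  exact ⟨f, by simpa using hf⟩

variable (A) in
theorem card_subgroup_le_pow_log :
    Nat.card (Subgroup A) ≤ Nat.card A ^ Nat.log 2 (Nat.card A) := by
  choose f hf using exists_closure_range_eq (A := A)
  have := Nat.card_le_card_of_injective f fun H K h => by rw [← hf H, ← hf K, h]
  simpa [Nat.card_fun] using this

variable (A) in
theorem card_mulAut_le_pow_log :
    Nat.card (A ≃* A) ≤ Nat.card A ^ Nat.log 2 (Nat.card A) := by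
  obtain ⟨f, hf⟩ := exists_closure_range_eq (⊤ : Subgroup A)
  have := Nat.card_le_card_of_injective (fun (φ : A ≃* A) i => φ (f i)) fun φ ψ h => by
    have : φ.toMonoidHom = ψ.toMonoidHom := by
      refine MonoidHom.eq_of_eqOn_dense hf ?_
      rintro _ ⟨i, rfl⟩
      exact congrFun h i
    ext x
    exact DFunLike.congr_fun this x
  simpa [Nat.card_fun] using this

end Generators

/-! ### Bipartite connection sets and exponential bounds -/

section

variable {A : Type*} [CommGroup A]

/-- The connection set of a bipartite Cayley digraph lies in a nontrivial coset of a subgroup. -/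
theorem exists_coset_of_mem_bipartiteSets {S : Set A} (hS : S ∈ bipartiteSets A) {s₀ : A}
    (hs₀ : s₀ ∈ S) : ∃ K : Subgroup A, s₀ ∉ K ∧ ∀ s ∈ S, s₀⁻¹ * s ∈ K := by
  obtain ⟨X, hX⟩ := hS
  have hflip : ∀ s ∈ S, ∀ x, s * x ∈ X ↔ x ∉ X := by
    intro s hs x
    have h : (cayleyDigraph S).Adj (s * x) x := by
      change s * x * x⁻¹ ∈ S
      rwa [mul_inv_cancel_right]
    rcases hX _ _ h with ⟨h1, h2⟩ | ⟨h1, h2⟩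
    · exact ⟨fun _ => h2, fun _ => h1⟩
    · exact ⟨fun h => absurd h h1, fun h => absurd h2 h⟩
  -- The translations preserving `X`. Elements of `S` swap `X` with its complement, so quotients of
  -- two of them preserve it.
  let K : Subgroup A :=
    { carrier := {c | ∀ x, c * x ∈ X ↔ x ∈ X}
      one_mem' := fun x => by simp
      mul_mem' := fun {c d} hc hd x => by rw [mul_assoc, hc, hd]
      inv_mem' := fun {c} hc x => by rw [← hc, mul_inv_cancel_left] }
  refine ⟨K, fun h => ?_, fun s hs x => ?_⟩
  · have h1 : s₀ * 1 ∈ X ↔ 1 ∈ X := h 1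
    rw [hflip s₀ hs₀] at h1
    tauto
  · have h1 := hflip s₀ hs₀ (s₀⁻¹ * s * x)
    rw [mul_assoc, mul_inv_cancel_left, hflip s hs] at h1
    rw [mul_assoc]
    tauto

theorem powerset_compl_subset_bipartiteSets {B : Subgroup A} (hB : B.index = 2) :
    𝒫 (B : Set A)ᶜ ⊆ bipartiteSets A := by
  intro S hS
  refine ⟨B, fun u v h => ?_⟩
  have h1 : u * v⁻¹ ∉ B := hS h
  rw [Subgroup.mul_mem_iff_of_index_two hB, inv_mem_iff] at h1
  simp only [Set.mem_compl_iff, SetLike.mem_coe]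
  tauto

variable [Finite A]

/-- An involution makes squaring non-injective, hence not surjective; a maximal subgroup containing
all squares has index 2. -/
theorem exists_subgroup_index_eq_two (hA : Even (Nat.card A)) :
    ∃ B : Subgroup A, B.index = 2 := by
  have hne : (powMonoidHom 2 : A →* A).range ≠ ⊤ := by
    intro h
    have hinj := Finite.injective_iff_surjective.mpr (MonoidHom.range_eq_top.mp h)
    obtain ⟨x, hx⟩ := exists_prime_orderOf_dvd_card' 2 hA.two_dvd
    have h1 : x ^ 2 = 1 := hx ▸ pow_orderOf_eq_one x
    have h2 : x = 1 := hinj (by simpa using h1)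
    rw [h2, orderOf_one] at hx
    omega
  obtain ⟨B, hB, hle⟩ := (eq_top_or_exists_le_coatom _).resolve_left hne
  have hsq : ∀ x : A, x ^ 2 ∈ B := fun x => hle ⟨x, rfl⟩
  obtain ⟨a, -, ha⟩ := SetLike.exists_of_lt (lt_top_iff_ne_top.mpr hB.1)
  refine ⟨B, Subgroup.index_eq_two_iff.mpr ⟨a, fun b => ?_⟩⟩
  by_cases hb : b ∈ B
  · exact Or.inr ⟨hb, fun h => ha ((B.mul_mem_cancel_left hb).mp h)⟩
  · refine Or.inl ⟨?_, hb⟩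
    have h1 : B ⊔ Subgroup.zpowers b = ⊤ := by
      refine hB.2 _ (lt_of_le_of_ne le_sup_left fun h => hb ?_)
      rw [h]
      exact (le_sup_right : _ ≤ B ⊔ _) (Subgroup.mem_zpowers b)
    obtain ⟨k, hk, _, ⟨i, rfl⟩, h2⟩ := Subgroup.mem_sup.mp (h1.symm ▸ Subgroup.mem_top a)
    rw [← h2]
    rcases Int.even_or_odd' i with ⟨j, rfl | rfl⟩
    · refine absurd ?_ ha
      rw [← h2]
      refine B.mul_mem hk ?_
      change b ^ (2 * j) ∈ B
      rw [zpow_mul, zpow_ofNat]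
      exact B.zpow_mem (hsq b) j
    · change b * (k * b ^ (2 * j + 1)) ∈ B
      have : b * (k * b ^ (2 * j + 1)) = k * (b ^ 2) ^ (j + 1) := by
        rw [mul_left_comm, ← zpow_one_add, ← zpow_natCast, ← zpow_mul]
        congr 2
        push_cast
        ring
      rw [this]
      exact B.mul_mem hk (B.zpow_mem (hsq b) _)

theorem two_mul_card_le_of_ne_top {C : Subgroup A} (hC : C ≠ ⊤) :
    2 * Nat.card C ≤ Nat.card A := by
  have h1 : C.index ≠ 1 := fun h => hC (Subgroup.index_eq_one.mp h)
  have h2 : C.index ≠ 0 := Subgroup.index_ne_zero_of_finite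
  rw [← C.card_mul_index, mul_comm]
  exact Nat.mul_le_mul_left _ (by omega)

theorem two_mul_ncard_compl_eq {B : Subgroup A} (hB : B.index = 2) :
    2 * (B : Set A)ᶜ.ncard = Nat.card A := by
  have h1 := B.card_mul_index
  rw [hB] at h1
  have h2 := Set.ncard_add_ncard_compl (B : Set A)
  rw [← Nat.card_coe_set_eq, SetLike.coe_sort_coe] at h2
  omega

/-- Translation by a point of `C` outside `B` sends `C \ B` into `C ∩ B`, so `C \ B` has at most
half of `C`. -/
theorem four_mul_ncard_compl_inter_le {B C : Subgroup A} (hB : B.index = 2) (hC : C ≠ ⊤) :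
    4 * ((B : Set A)ᶜ ∩ C).ncard ≤ Nat.card A := by
  rcases ((B : Set A)ᶜ ∩ C).eq_empty_or_nonempty with h | ⟨c, hc, hcC⟩
  · simp [h]
  · have h1 : ((B : Set A)ᶜ ∩ C).ncard ≤ ((C : Set A) ∩ B).ncard := by
      refine Set.ncard_le_ncard_of_injOn (c * ·) (fun x hx => ⟨C.mul_mem hcC hx.2, ?_⟩)
        (fun x _ y _ h => mul_left_cancel h) (Set.toFinite _)
      exact (Subgroup.mul_mem_iff_of_index_two hB).mpr ⟨fun h => absurd h hc, fun h => absurd h hx.1⟩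
    have h2 := Set.ncard_inter_add_ncard_sdiff_eq_ncard (C : Set A) B (Set.toFinite _)
    rw [Set.sdiff_eq, Set.inter_comm (C : Set A) (B : Set A)ᶜ, ← Nat.card_coe_set_eq (C : Set A),
      SetLike.coe_sort_coe] at h2
    have h3 := two_mul_card_le_of_ne_top hC
    omega

/-- The exponent `31/64 = 1/2 - 1/64` is dictated by the locally invariant sets; the other families
satisfy smaller bounds. -/
theorem cast_le_rpow_of_pow_le {N k e n : ℕ} (hk : k ≠ 0) (h : N ^ k ≤ 2 ^ e)
    (he : 64 * e ≤ 31 * n * k) : (N : ℝ) ≤ 2 ^ (31 / 64 * n : ℝ) := by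
  refine le_of_pow_le_pow_left₀ hk (by positivity) ?_
  calc (N : ℝ) ^ k ≤ 2 ^ e := by exact_mod_cast h
    _ = (2 : ℝ) ^ (e : ℝ) := (Real.rpow_natCast _ _).symm
    _ ≤ (2 : ℝ) ^ ((31 / 64 * n : ℝ) * k) := by
      refine Real.rpow_le_rpow_of_exponent_le one_le_two ?_
      have : (64 * e : ℝ) ≤ 31 * n * k := by exact_mod_cast he
      linarith
    _ = _ := by rw [Real.rpow_mul two_pos.le, Real.rpow_natCast]

theorem ncard_le_of_subset_powerset {X : Type*} [Finite X] {𝒮 : Set (Set X)} {T : Set X}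
    (h𝒮 : ∀ S ∈ 𝒮, 3 * T.ncard ≤ Nat.card X ∧ S ⊆ T) :
    (𝒮.ncard : ℝ) ≤ 2 ^ (31 / 64 * Nat.card X : ℝ) := by
  rcases 𝒮.eq_empty_or_nonempty with rfl | ⟨S, hS⟩
  · simp only [Set.ncard_empty, Nat.cast_zero]
    positivity
  · have hT := (h𝒮 S hS).1
    refine cast_le_rpow_of_pow_le one_ne_zero (e := T.ncard) ?_ (by omega)
    rw [pow_one, ← Set.ncard_powerset _ (Set.toFinite _)]
    exact Set.ncard_le_ncard (fun S hS => (h𝒮 S hS).2) (Set.toFinite _)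

theorem ncard_mulEquiv_invariant_le (B : Subgroup A) (φ : A ≃* A) :
    ({S : Set A | B.index = 2 ∧ φ ≠ 1 ∧ S ⊆ (B : Set A)ᶜ ∧ ∀ x, φ x ∈ S ↔ x ∈ S}.ncard : ℝ) ≤
      2 ^ (31 / 64 * Nat.card A : ℝ) := by
  by_cases h : B.index = 2 ∧ φ ≠ 1
  · obtain ⟨hB, hφ⟩ := h
    have h1 := ncard_invariant_subsets_sq_le φ.toEquiv (B : Set A)ᶜ
    let F : Subgroup A := φ.toMonoidHom.eqLocus (MonoidHom.id A)
    have hF : F ≠ ⊤ := by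
      intro h
      refine hφ (MulEquiv.ext fun x => ?_)
      have : x ∈ F := h ▸ Subgroup.mem_top x
      exact this
    have h2 := four_mul_ncard_compl_inter_le hB hF
    have h3 := two_mul_ncard_compl_eq hB
    have h4 : ({x | φ.toEquiv x = x} : Set A) = F := rfl
    rw [h4] at h1
    refine cast_le_rpow_of_pow_le two_ne_zero ((Nat.pow_le_pow_left ?_ 2).trans h1) (by omega)
    exact Set.ncard_le_ncard (fun S hS => ⟨hS.2.2.1, hS.2.2.2⟩) (Set.toFinite _)
  · have : {S : Set A | B.index = 2 ∧ φ ≠ 1 ∧ S ⊆ (B : Set A)ᶜ ∧ ∀ x, φ x ∈ S ↔ x ∈ S} = ∅ := by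
      ext S
      simp only [Set.mem_ofPred_eq, Set.mem_empty_iff_false, iff_false]
      tauto
    rw [this, Set.ncard_empty, Nat.cast_zero]
    positivity

theorem ncard_coset_invariant_le (B Z M : Subgroup A) :
    ({S : Set A | (B.index = 2 ∧ Z ≤ B ∧ Z ≤ M ∧ M ≠ ⊤) ∧ S ⊆ (B : Set A)ᶜ ∧ ∀ a ∉ M, ∃ w ∈ Z,
      w ≠ 1 ∧ ∀ z ∈ Z, a * w * z ∈ S ↔ a * z ∈ S}.ncard : ℝ) ≤
      2 ^ (31 / 64 * Nat.card A : ℝ) := by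
  by_cases h : B.index = 2 ∧ Z ≤ B ∧ Z ≤ M ∧ M ≠ ⊤
  · obtain ⟨hB, hZB, hZM, hM⟩ := h
    have hD : ∀ a ∈ (B : Set A)ᶜ \ M, ∀ z ∈ Z, a * z ∈ (B : Set A)ᶜ \ M := by
      rintro a ⟨haB, haM⟩ z hz
      exact ⟨fun h => haB ((B.mul_mem_cancel_right (hZB hz)).mp h),
        fun h => haM ((M.mul_mem_cancel_right (hZM hz)).mp h)⟩
    have h1 := ncard_locally_invariant_pow_mul_le Z Set.sdiff_subset hD
    have h2 := four_mul_ncard_compl_inter_le hB hM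
    have h3 := two_mul_ncard_compl_eq hB
    have h4 := Set.ncard_inter_add_ncard_sdiff_eq_ncard (B : Set A)ᶜ M (Set.toFinite _)
    set D := (B : Set A)ᶜ \ M
    -- Here `D` has at least `|A|/4` points, so the saving `|D|/16` in the exponent is at least
    -- `|A|/64`.
    have h5 : 16 * (B : Set A)ᶜ.ncard = 16 * (B : Set A)ᶜ.ncard - D.ncard + D.ncard := by omega
    rw [h5, pow_add] at h1
    refine cast_le_rpow_of_pow_le (by norm_num)
      ((Nat.pow_le_pow_left ?_ 16).trans (Nat.le_of_mul_le_mul_right h1 (by positivity)))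
      (by omega)
    exact Set.ncard_le_ncard (fun S hS => ⟨hS.2.1, fun a ha => hS.2.2 a ha.2⟩) (Set.toFinite _)
  · simp only [h, false_and, Set.ofPred_false, Set.ncard_empty, Nat.cast_zero]
    positivity

variable (A) in
/-- The connection sets of bipartite Cayley digraphs that are not DRRs are few. -/
theorem ncard_bipartiteSets_diff_le (hA : 3 ≤ Nat.card A) :
    ((bipartiteSets A \ bipartiteDRRSets A).ncard : ℝ) ≤
      4 * ((Nat.card A : ℝ) ^ Nat.log 2 (Nat.card A)) ^ 3 * 2 ^ (31 / 64 * Nat.card A : ℝ) := by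
  set c : ℝ := 2 ^ (31 / 64 * Nat.card A : ℝ) with hc
  set q : ℕ := Nat.card A ^ Nat.log 2 (Nat.card A) with hq
  have hc0 : 0 ≤ c := by positivity
  have hlog : 1 ≤ Nat.log 2 (Nat.card A) := Nat.log_pos one_lt_two (by omega)
  have hA' : Nat.card A ≤ q := Nat.le_self_pow (by omega) _
  have hq1 : 1 ≤ q := by omega
  have hL : Nat.card (Subgroup A) ≤ q := card_subgroup_le_pow_log A
  have hAut : Nat.card (A ≃* A) ≤ q := card_mulAut_le_pow_log A
  -- The four kinds of bad sets: inside a small coset, non-generating, invariant under an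
  -- automorphism, locally translation-invariant.
  set U₁ := ⋃ i : Subgroup A × A, {S : Set A | 3 * ((i.2 * ·) '' (i.1 : Set A)).ncard ≤ Nat.card A ∧
    S ⊆ (i.2 * ·) '' i.1} with hU₁
  set U₂ := ⋃ i : Subgroup A × Subgroup A, {S : Set A | (i.1.index = 2 ∧ i.2 ≠ ⊤) ∧
    S ⊆ (i.1 : Set A)ᶜ ∩ i.2} with hU₂
  set U₃ := ⋃ i : Subgroup A × (A ≃* A), {S : Set A | i.1.index = 2 ∧ i.2 ≠ 1 ∧
    S ⊆ (i.1 : Set A)ᶜ ∧ ∀ x, i.2 x ∈ S ↔ x ∈ S} with hU₃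
  set U₄ := ⋃ i : Subgroup A × Subgroup A × Subgroup A, {S : Set A |
    (i.1.index = 2 ∧ i.2.1 ≤ i.1 ∧ i.2.1 ≤ i.2.2 ∧ i.2.2 ≠ ⊤) ∧ S ⊆ (i.1 : Set A)ᶜ ∧
    ∀ a ∉ i.2.2, ∃ w ∈ i.2.1, w ≠ 1 ∧ ∀ z ∈ i.2.1, a * w * z ∈ S ↔ a * z ∈ S} with hU₄
  have bound : ∀ (N m : ℕ) , (N : ℝ) ≤ m * c → m ≤ q ^ 3 → (N : ℝ) ≤ (q : ℝ) ^ 3 * c := by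
    intro N m h hm
    refine h.trans (mul_le_mul_of_nonneg_right ?_ hc0)
    exact_mod_cast hm
  have hq2 : q * q ≤ q ^ 3 := by
    rw [← sq]
    exact Nat.pow_le_pow_right hq1 (by norm_num)
  have h₁ : (U₁.ncard : ℝ) ≤ (q : ℝ) ^ 3 * c := by
    refine bound _ _ (ncard_iUnion_le_card_mul _ fun i => ncard_le_of_subset_powerset
      fun S hS => hS) ?_
    rw [Nat.card_prod]
    exact (Nat.mul_le_mul hL hA').trans hq2
  have h₂ : (U₂.ncard : ℝ) ≤ (q : ℝ) ^ 3 * c := by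
    refine bound _ _ (ncard_iUnion_le_card_mul _ fun i => ncard_le_of_subset_powerset
      (T := (i.1 : Set A)ᶜ ∩ i.2) fun S hS => ⟨?_, hS.2⟩) ?_
    · have := four_mul_ncard_compl_inter_le hS.1.1 hS.1.2
      omega
    · rw [Nat.card_prod]
      exact (Nat.mul_le_mul hL hL).trans hq2
  have h₃ : (U₃.ncard : ℝ) ≤ (q : ℝ) ^ 3 * c := by
    refine bound _ _ (ncard_iUnion_le_card_mul _ fun i => ncard_mulEquiv_invariant_le i.1 i.2) ?_
    rw [Nat.card_prod]
    exact (Nat.mul_le_mul hL hAut).trans hq2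
  have h₄ : (U₄.ncard : ℝ) ≤ (q : ℝ) ^ 3 * c := by
    refine bound _ _ (ncard_iUnion_le_card_mul _ fun i =>
      ncard_coset_invariant_le i.1 i.2.1 i.2.2) ?_
    rw [Nat.card_prod, Nat.card_prod]
    calc _ ≤ q * (q * q) := Nat.mul_le_mul hL (Nat.mul_le_mul hL hL)
      _ = q ^ 3 := by ring
  have hsub : bipartiteSets A \ bipartiteDRRSets A ⊆ U₁ ∪ (U₂ ∪ (U₃ ∪ U₄)) := by
    rintro S ⟨hS, hD⟩
    replace hD : ¬ IsDRR S := fun h => hD ⟨hS, h⟩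
    rcases S.eq_empty_or_nonempty with rfl | ⟨s₀, hs₀⟩
    · left
      -- Any small coset contains the empty set; a singleton is small because `3 ≤ |A|`.
      refine Set.mem_iUnion.mpr ⟨(⊥, 1), ?_, Set.empty_subset _⟩
      simpa using hA
    obtain ⟨B, hsB, hB⟩ := exists_coset_of_mem_bipartiteSets hS hs₀
    by_cases hB2 : B.index = 2
    swap
    · left
      refine Set.mem_iUnion.mpr ⟨(B, s₀), ?_, fun s hs => ⟨_, hB s hs, by simp⟩⟩
      have h1 : B.index ≠ 1 := fun h => hsB (Subgroup.index_eq_one.mp h ▸ Subgroup.mem_top s₀)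
      have h2 : B.index ≠ 0 := Subgroup.index_ne_zero_of_finite
      rw [Set.ncard_image_of_injective _ (mul_right_injective s₀), ← Nat.card_coe_set_eq,
        SetLike.coe_sort_coe, ← B.card_mul_index, mul_comm]
      exact Nat.mul_le_mul_left _ (by omega)
    right
    have hSB : ∀ s ∈ S, s ∉ B := fun s hs hsB' =>
      hsB (B.inv_mem_iff.mp ((B.mul_mem_cancel_right hsB').mp (hB s hs)))
    by_cases hcl : Subgroup.closure S = ⊤
    swap
    · left
      exact Set.mem_iUnion.mpr ⟨(B, Subgroup.closure S), ⟨hB2, hcl⟩,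
        fun s hs => ⟨hSB s hs, Subgroup.subset_closure hs⟩⟩
    right
    rcases exists_mulEquiv_or_exists_local_translation hB2 hSB hcl hD with
      ⟨φ, hφ, h⟩ | ⟨Z, M, hZB, hZM, hM, h⟩
    · left
      exact Set.mem_iUnion.mpr ⟨(B, φ), hB2, hφ, hSB, h⟩
    · right
      exact Set.mem_iUnion.mpr ⟨(B, Z, M), ⟨hB2, hZB, hZM, hM⟩, hSB, h⟩
  have hle : (bipartiteSets A \ bipartiteDRRSets A).ncard ≤
      U₁.ncard + (U₂.ncard + (U₃.ncard + U₄.ncard)) :=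
    (Set.ncard_le_ncard hsub (Set.toFinite _)).trans <| (Set.ncard_union_le _ _).trans <|
      Nat.add_le_add_left ((Set.ncard_union_le _ _).trans <|
        Nat.add_le_add_left (Set.ncard_union_le _ _) _) _
  have hle' : ((bipartiteSets A \ bipartiteDRRSets A).ncard : ℝ) ≤
      U₁.ncard + (U₂.ncard + (U₃.ncard + U₄.ncard)) := by exact_mod_cast hle
  have hqr : (q : ℝ) = (Nat.card A : ℝ) ^ Nat.log 2 (Nat.card A) := by
    rw [hq]
    push_cast
    rfl
  rw [← hqr]
  linarith

theorem two_rpow_le_ncard_bipartiteSets (hA : Even (Nat.card A)) :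
    (2 : ℝ) ^ (1 / 2 * Nat.card A : ℝ) ≤ (bipartiteSets A).ncard := by
  obtain ⟨B, hB⟩ := exists_subgroup_index_eq_two hA
  have h1 := Set.ncard_le_ncard (powerset_compl_subset_bipartiteSets hB) (Set.toFinite _)
  rw [Set.ncard_powerset _ (Set.toFinite _)] at h1
  have h2 : (1 / 2 * Nat.card A : ℝ) = ((B : Set A)ᶜ.ncard : ℕ) := by
    rw [← two_mul_ncard_compl_eq hB]
    push_cast
    ring
  rw [h2, Real.rpow_natCast]
  exact_mod_cast h1

end

/-! ### Asymptotics -/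

/-- With `k = Nat.log 2 n`, the quadratic collects the exponents of the subexponential factors, and
the gap `n/64` between `n/2` and `31n/64` absorbs it. -/
theorem quadratic_le_two_pow {k : ℕ} (hk : 17 ≤ k) : 64 * (3 * k ^ 2 + 4 * k + 2) ≤ 2 ^ k := by
  induction k, hk using Nat.le_induction with
  | base => norm_num
  | succ k hk ih =>
    have h1 : 64 * (3 * (k + 1) ^ 2 + 4 * (k + 1) + 2) ≤ 2 * (64 * (3 * k ^ 2 + 4 * k + 2)) := by
      nlinarith
    exact h1.trans ((Nat.mul_le_mul_left 2 ih).trans_eq (pow_succ' 2 k).symm)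

/-- The proportion of connection sets excluded by the counting bounds is at most `2 / n`. -/
theorem four_mul_pow_log_mul_rpow_le {n : ℕ} (hn : 2 ^ 17 ≤ n) :
    4 * ((n : ℝ) ^ Nat.log 2 n) ^ 3 * 2 ^ (31 / 64 * n : ℝ) ≤ 2 / n * 2 ^ (1 / 2 * n : ℝ) := by
  set k := Nat.log 2 n with hk
  have hn0 : n ≠ 0 := by
    rintro rfl
    norm_num at hn
  have hk17 : 17 ≤ k := Nat.le_log_of_pow_le one_lt_two hn
  have h1 : 2 ^ k ≤ n := Nat.pow_log_le_self 2 hn0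
  have h2 : n < 2 ^ (k + 1) := Nat.lt_pow_succ_log_self one_lt_two n
  have h2' : (n : ℝ) ≤ 2 ^ (k + 1) := by exact_mod_cast h2.le
  have h3 := (quadratic_le_two_pow hk17).trans h1
  have h3' : (64 * (3 * k ^ 2 + 4 * k + 2) : ℝ) ≤ n := by exact_mod_cast h3
  have hnpos : (0 : ℝ) < n := by positivity
  have key : 4 * ((n : ℝ) ^ k) ^ 3 * 2 ^ (31 / 64 * n : ℝ) * n ≤ 2 * 2 ^ (1 / 2 * n : ℝ) := by
    calc 4 * ((n : ℝ) ^ k) ^ 3 * 2 ^ (31 / 64 * n : ℝ) * n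
        ≤ 4 * (((2 : ℝ) ^ (k + 1)) ^ k) ^ 3 * 2 ^ (31 / 64 * n : ℝ) * 2 ^ (k + 1) := by gcongr
      _ = 2 * ((2 : ℝ) ^ (3 * k ^ 2 + 4 * k + 2) * 2 ^ (31 / 64 * n : ℝ)) := by ring
      _ ≤ 2 * 2 ^ (1 / 2 * n : ℝ) := by
        rw [← Real.rpow_natCast, ← Real.rpow_add two_pos]
        refine mul_le_mul_of_nonneg_left (Real.rpow_le_rpow_of_exponent_le one_le_two ?_) two_pos.le
        push_cast
        linarith
  rw [div_mul_eq_mul_div (2 : ℝ) (n : ℝ), le_div_iff₀ hnpos]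
  exact key

theorem corollary1p3 :
    ∀ ε : ℝ, 0 < ε → ∃ N : ℕ, ∀ (A : Type*) [CommGroup A] [Finite A],
      Even (Nat.card A) → N ≤ Nat.card A →
        |((bipartiteDRRSets A).ncard : ℝ) / ((bipartiteSets A).ncard : ℝ) - 1| < ε := by
  intro ε hε
  -- The first term validates the counting estimate, whose bad proportion is at most `2 / |A|`; the
  -- second makes this less than `ε`.
  refine ⟨max (2 ^ 17) (⌊2 / ε⌋₊ + 1), fun A _ _ hA hN => ?_⟩
  have hn : 2 ^ 17 ≤ Nat.card A := (le_max_left _ _).trans hN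
  have hn' : 2 / ε < Nat.card A := (Nat.lt_floor_add_one _).trans_le
    (by exact_mod_cast (le_max_right _ _).trans hN)
  have hbad := (ncard_bipartiteSets_diff_le A (le_trans (by norm_num) hn)).trans
    (four_mul_pow_log_mul_rpow_le hn)
  have hall := two_rpow_le_ncard_bipartiteSets hA
  have hpos : (0 : ℝ) < 2 ^ (1 / 2 * Nat.card A : ℝ) := by positivity
  have hSpos := hpos.trans_le hall
  have hsub : bipartiteDRRSets A ⊆ bipartiteSets A := fun S hS => hS.1
  have hsum : ((bipartiteSets A \ bipartiteDRRSets A).ncard : ℝ) + (bipartiteDRRSets A).ncard =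
      (bipartiteSets A).ncard := by
    exact_mod_cast Set.ncard_sdiff_add_ncard_of_subset hsub (Set.toFinite _)
  have hnpos : (0 : ℝ) < Nat.card A := (by positivity : 0 < 2 / ε).trans hn'
  have hlt : (2 : ℝ) / Nat.card A < ε := by
    rw [div_lt_iff₀ hε] at hn'
    rwa [div_lt_iff₀ hnpos, mul_comm]
  rw [div_sub_one hSpos.ne', abs_div, abs_sub_comm, ← eq_sub_of_add_eq hsum, abs_of_nonneg (Nat.cast_nonneg _), abs_of_pos hSpos, div_lt_iff₀ hSpos]
  calc _ ≤ 2 / (Nat.card A : ℝ) * 2 ^ (1 / 2 * Nat.card A : ℝ) := hbad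
    _ < ε * 2 ^ (1 / 2 * Nat.card A : ℝ) := mul_lt_mul_of_pos_right hlt hpos
    _ ≤ _ := mul_le_mul_of_nonneg_left hall hε.le
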